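/- Let $A$ be a (not necessarily unital) C*-algebra with set of positive elements $A_+$. By an ideal of $A$ we mean a two-sided ideal that need not be norm-closed, i.e. an additive subgroup $I\subseteq A$ with $aI\cup Ia\subseteq I$ for all $a\in A$ (so $I$ need not be closed under scalar multiplication). For $n\geq 1$ let $I^n$ be the additive subgroup generated by all products $x_1\cdots x_n$ with $x_1,\dots,x_n\in I$; it is again an ideal. An ideal $I$ is semiprime if $J^2\subseteq I$ implies $J\subseteq I$ for every ideal $J$ of $A$. Put $I_+:=I\cap A_+$. An ideal $I$ is a Dixmier ideal if (i) $I$ is the complex linear span of $I_+$; (ii) $a\in A$, $x\in I$ and $0\leq a\leq x$ imply $a\in I$; and (iii) for all $x\in A$, $x^*x\in I_+$ if and only if $xx^*\in I_+$. The Dixmier interior of an ideal $I$ is the supremum, in the lattice of ideals of $A$, of all Dixmier ideals contained in $I$; the Dixmier closure of $I$ is the infimum (intersection) of all Dixmier ideals containing $I$. Theorem. Let $I$ be an ideal of $A$. The following are equivalent: (1) $I$ is semiprime; (2) $I$ is idempotent, that is, $I=I^2$; equivalently, $I$ factors weakly, that is, $I$ is the complex linear span of $\{yz : y,z\in I\}$;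 (3) $I^m=I^n$ for some integers $m,n\geq 1$ with $m\neq n$; (4) $I$ factors, that is, for every $x\in I$ there are $y,z\in I$ with $x=yz$; (5) $I$ is closed under arbitrary roots of positive elements, that is, $a^{1/n}\in I$ for all $a\in I_+$ and all integers $n\geq 1$; (6) $I$ is closed under square roots of positive elements, that is, $a^{1/2}\in I$ for all $a\in I_+$; (7) the Dixmier interior of $I$ is semiprime; (8) the Dixmier closure of $I$ is semiprime. If these conditions hold, then $I$ is a Dixmier ideal and is equal to both its Dixmier interior and its Dixmier closure. -/

import Mathlib

open scoped NNReal

namespace TwoSidedIdeal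

section Algebra

variable {A : Type*} [NonUnitalRing A]

/-- `IsProductOf I n p` says that `p = x₁ * ⋯ * xₙ` with `n ≥ 1` and `x₁, …, xₙ ∈ I`. -/
inductive IsProductOf (I : TwoSidedIdeal A) : ℕ → A → Prop
  | single {x : A} (hx : x ∈ I) : IsProductOf I 1 x
  | mul {n : ℕ} {p x : A} (hp : IsProductOf I n p) (hx : x ∈ I) : IsProductOf I (n + 1) (p * x)

theorem IsProductOf.mul_left {I : TwoSidedIdeal A} {n : ℕ} {p : A} (h : IsProductOf I n p)
    (a : A) : IsProductOf I n (a * p) := by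
  induction h with
  | single hx => exact .single (I.mul_mem_left _ _ hx)
  | mul _ hx ih => rw [← mul_assoc]; exact .mul ih hx

theorem IsProductOf.mul_right {I : TwoSidedIdeal A} {n : ℕ} {p : A} (h : IsProductOf I n p)
    (a : A) : IsProductOf I n (p * a) := by
  cases h with
  | single hx => exact .single (I.mul_mem_right _ _ hx)
  | mul hp hx => rw [mul_assoc]; exact .mul hp (I.mul_mem_right _ _ hx)

/-- The power `Iⁿ`, `n ≥ 1`: the additive subgroup generated by all products `x₁ * ⋯ * xₙ` of
`n` elements of `I`, which is again a two-sided ideal. (The ring need not have a unit; the value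
at `n = 0` has no meaning and is never used.) -/
def idealPow (I : TwoSidedIdeal A) (n : ℕ) : TwoSidedIdeal A :=
  TwoSidedIdeal.mk' (AddSubgroup.closure {p : A | IsProductOf I n p} : Set A)
    (AddSubgroup.zero_mem _)
    (fun hx hy => AddSubgroup.add_mem _ hx hy)
    (fun hx => AddSubgroup.neg_mem _ hx)
    (by
      intro a y hy
      have : AddSubgroup.closure {p : A | IsProductOf I n p} ≤
          (AddSubgroup.closure {p : A | IsProductOf I n p}).comap (AddMonoidHom.mulLeft a) :=
        (AddSubgroup.closure_le _).2 fun p hp => AddSubgroup.subset_closure (hp.mul_left a)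
      exact this hy)
    (by
      intro y a hy
      have : AddSubgroup.closure {p : A | IsProductOf I n p} ≤
          (AddSubgroup.closure {p : A | IsProductOf I n p}).comap (AddMonoidHom.mulRight a) :=
        (AddSubgroup.closure_le _).2 fun p hp => AddSubgroup.subset_closure (hp.mul_right a)
      exact this hy)

theorem mem_idealPow {I : TwoSidedIdeal A} {n : ℕ} {x : A} :
    x ∈ I.idealPow n ↔ x ∈ AddSubgroup.closure {p : A | IsProductOf I n p} :=
  TwoSidedIdeal.mem_mk' _ _ _ _ _ _ x

/-- `I` is semiprime if `J² ⊆ I` implies `J ⊆ I`, for all two-sided ideals `J`. -/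
def IsSemiprimeIdeal (I : TwoSidedIdeal A) : Prop :=
  ∀ J : TwoSidedIdeal A, J.idealPow 2 ≤ I → J ≤ I

/-- `I` factors if every element of `I` is a product of two elements of `I`. -/
def Factors (I : TwoSidedIdeal A) : Prop :=
  ∀ x ∈ I, ∃ y ∈ I, ∃ z ∈ I, x = y * z

end Algebra

section CStar

variable {A : Type*} [NonUnitalCStarAlgebra A] [PartialOrder A] [StarOrderedRing A]

/-- `I` factors weakly if it is the complex linear span of products of two of its elements. -/
def FactorsWeakly (I : TwoSidedIdeal A) : Prop :=
  (I : Set A) = Submodule.span ℂ {p : A | ∃ y ∈ I, ∃ z ∈ I, p = y * z}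

/-- `I` is closed under arbitrary (`n`-th) roots of positive elements; the power is taken in the
continuous functional calculus. -/
def ClosedUnderRoots (I : TwoSidedIdeal A) : Prop :=
  ∀ a ∈ I, 0 ≤ a → ∀ n : ℕ, 1 ≤ n → a ^ ((n : ℝ≥0)⁻¹) ∈ I

/-- `I` is closed under square roots of positive elements. -/
def ClosedUnderSqrt (I : TwoSidedIdeal A) : Prop :=
  ∀ a ∈ I, 0 ≤ a → CFC.sqrt a ∈ I

/-- A Dixmier ideal: a two-sided ideal that is positively spanned and hereditary and whose
positive part is strongly invariant. -/
structure IsDixmier (I : TwoSidedIdeal A) : Prop where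
  positivelySpanned : (I : Set A) = Submodule.span ℂ {a : A | a ∈ I ∧ 0 ≤ a}
  hereditary : ∀ a : A, ∀ x ∈ I, 0 ≤ a → a ≤ x → a ∈ I
  stronglyInvariant : ∀ x : A, star x * x ∈ I ↔ x * star x ∈ I

/-- The Dixmier interior: the supremum, in the lattice of two-sided ideals, of all Dixmier ideals
contained in `I`. -/
def dixmierInterior (I : TwoSidedIdeal A) : TwoSidedIdeal A :=
  sSup {J : TwoSidedIdeal A | J.IsDixmier ∧ J ≤ I}

/-- The Dixmier closure: the infimum, in the lattice of two-sided ideals, of all Dixmier ideals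
containing `I`. -/
def dixmierClosure (I : TwoSidedIdeal A) : TwoSidedIdeal A :=
  sInf {J : TwoSidedIdeal A | J.IsDixmier ∧ I ≤ J}

end CStar

end TwoSidedIdeal

/-!
The proof rests on squeezing an arbitrary ideal `I` between two Dixmier ideals `K ≤ I ≤ L` with
`L ^ 2 ≤ K` (`dixmierInner_le`, `le_dixmierOuter`, `dixmierOuter_idealPow_two_le`).

The ideal `K` is the span of the positive elements `a` such that `a ^ p ∈ I` for some `p < 1`. For
this to be a Dixmier ideal one needs that membership of powers in `I` is stable under sums
(`add_nnrpow_mem`), under passage to smaller positive elements (`nnrpow_mem_of_le_of_nnrpow_mem`)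
and under passage from `star x * x` to `x * star x` (`mul_star_self_nnrpow_mem`), where an
arbitrarily small increase of the exponent is permitted. All three follow from the factorization
`x = u * b ^ p` for `star x * x ≤ b` and `p < 1 / 2` (`exists_eq_mul_nnrpow`), which replaces the
polar decomposition.

Positive parts of Dixmier ideals are described by Dixmier cones. Every Dixmier cone `P` spans a
Dixmier ideal with positive part `P`, and the positive elements with square in `P` form another
Dixmier cone (`IsDixmierCone.sqrt`), whose span has its square contained in the span of `P` by
polarization. Applied to the cone of `K`, this construction gives `L`.

If `I` is semiprime, then `L ^ 2 ≤ I` gives `I = L`. Hence `I` is a Dixmier ideal, and the square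
root of its cone spans an ideal with square in `I`, so `I` is closed under square roots. If `I` is
idempotent, then `I = I ^ 2 ≤ L ^ 2 ≤ K`, and the same squeeze with exponents below `1 / 2` yields
closure under square roots. Conversely, closure under square roots gives closure under all roots,
and `x` is a multiple of `(star x * x) ^ (1 / 4)`, whence factorization and semiprimeness. If
`I ^ m = I ^ n` with `m < n`, then `I ^ m` is idempotent, hence semiprime, hence equal to `I`. Finally,
the Dixmier interior contains `K` and the Dixmier closure is contained in `L`, so the square of
the closure lies in the interior; if either of them is semiprime, both coincide with `I`.
-/

/-! ### Truncated powers on the half-line -/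

namespace CStarAlgebra

section Scalar

/-- A continuous approximation to `t ↦ t ^ (-p)` on `[0, ∞)` which vanishes at `0`, so that it can
be used in the non-unital functional calculus: it agrees with `t ^ (-p)` for `t ≥ δ` and is linear
on `[0, δ]`. -/
noncomputable def truncPow (p δ t : ℝ) : ℝ := t / max t δ ^ (1 + p)

variable {p δ t : ℝ}

theorem truncPow_zero : truncPow p δ 0 = 0 := by simp [truncPow]

theorem continuous_truncPow (hδ : 0 < δ) : Continuous (truncPow p δ) := by
  unfold truncPow
  have h : ∀ t : ℝ, 0 < max t δ := fun t => lt_max_of_lt_right hδ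
  refine continuous_id.div ?_ fun t => (Real.rpow_pos_of_pos (h t) _).ne'
  exact (continuous_id.max continuous_const).rpow_const fun t => Or.inl (h t).ne'

theorem truncPow_of_le (hδ : 0 < δ) (h : δ ≤ t) : truncPow p δ t = t ^ (-p) := by
  have ht : 0 < t := hδ.trans_le h
  rw [truncPow, max_eq_left h, Real.rpow_add ht, Real.rpow_one, Real.rpow_neg ht.le]
  field_simp

theorem truncPow_nonneg (ht : 0 ≤ t) : 0 ≤ truncPow p δ t :=
  div_nonneg ht (Real.rpow_nonneg (le_max_of_le_left ht) _)

theorem truncPow_le (hp : 0 ≤ p) (ht : 0 < t) : truncPow p δ t ≤ t ^ (-p) := by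
  have : t ^ (-p) = t / t ^ (1 + p) := by
    rw [Real.rpow_add ht, Real.rpow_one, Real.rpow_neg ht.le]
    field_simp
  rw [this, truncPow]
  gcongr
  exact le_max_left _ _

theorem abs_sqrt_mul_truncPow_sub_le {ε δ' : ℝ} (hp : 0 ≤ p) (hp' : p < 1 / 2) (hδ : 0 < δ)
    (hδ' : 0 < δ') (h : δ ≤ ε) (h' : δ' ≤ ε) (ht : 0 ≤ t) :
    |√t * (truncPow p δ t - truncPow p δ' t)| ≤ ε ^ (1 / 2 - p) := by
  have hε : 0 < ε := hδ.trans_le h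
  rcases ht.eq_or_lt with rfl | ht
  · simpa using Real.rpow_nonneg hε.le _
  rcases le_total ε t with hεt | hεt
  · rw [truncPow_of_le hδ (h.trans hεt), truncPow_of_le hδ' (h'.trans hεt)]
    simpa using Real.rpow_nonneg hε.le _
  · have h1 : |truncPow p δ t - truncPow p δ' t| ≤ t ^ (-p) :=
      abs_sub_le_of_nonneg_of_le (truncPow_nonneg ht.le) (truncPow_le hp ht)
        (truncPow_nonneg ht.le) (truncPow_le hp ht)
    rw [abs_mul, abs_of_nonneg (Real.sqrt_nonneg t)]
    calc √t * _ ≤ √t * t ^ (-p) := by gcongr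
      _ = t ^ (1 / 2 - p) := by rw [Real.sqrt_eq_rpow, ← Real.rpow_add ht]; rfl
      _ ≤ _ := Real.rpow_le_rpow ht.le hεt (by linarith)

theorem abs_sqrt_mul_truncPow_mul_sub_le (hp : 0 ≤ p) (hδ : 0 < δ) (ht : 0 ≤ t) :
    |√t * (truncPow p δ t * (t ^ p * t) - t)| ≤ √δ * δ := by
  rcases ht.eq_or_lt with rfl | ht
  · simp; positivity
  have h0 : t ^ (-p) * (t ^ p * t) = t := by
    rw [← mul_assoc, ← Real.rpow_add ht]; simp
  rcases le_total δ t with hδt | hδt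
  · rw [truncPow_of_le hδ hδt, h0]
    simp; positivity
  · have h2 : truncPow p δ t * (t ^ p * t) ≤ t := by
      have := mul_le_mul_of_nonneg_right (truncPow_le (δ := δ) hp ht)
        (by positivity : 0 ≤ t ^ p * t)
      rwa [h0] at this
    have h3 : 0 ≤ truncPow p δ t * (t ^ p * t) :=
      mul_nonneg (truncPow_nonneg ht.le) (by positivity)
    have h1 : |truncPow p δ t * (t ^ p * t) - t| ≤ t :=
      abs_sub_le_of_nonneg_of_le h3 h2 ht.le le_rfl
    rw [abs_mul, abs_of_nonneg (Real.sqrt_nonneg t)]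
    gcongr
    exact h1.trans hδt

theorem abs_truncPow_mul_mul_sub_le (hp : 0 ≤ p) (hp' : p < 1 / 2) (hδ : 0 < δ) (ht : 0 ≤ t) :
    |truncPow p δ t * (t * truncPow p δ t) - t ^ (1 - 2 * p)| ≤ δ ^ (1 - 2 * p) := by
  rcases ht.eq_or_lt with rfl | ht
  · rw [truncPow_zero, Real.zero_rpow (by linarith)]
    simpa using Real.rpow_nonneg hδ.le _
  have h0 : t ^ (-p) * (t * t ^ (-p)) = t ^ (1 - 2 * p) := by
    nth_rewrite 2 [← Real.rpow_one t]
    rw [← Real.rpow_add ht, ← Real.rpow_add ht]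
    ring_nf
  rcases le_total δ t with hδt | hδt
  · rw [truncPow_of_le hδ hδt, h0]
    simpa using Real.rpow_nonneg hδ.le _
  · have h1 := truncPow_nonneg (p := p) (δ := δ) ht.le
    have h2 : truncPow p δ t * (t * truncPow p δ t) ≤ t ^ (1 - 2 * p) := by
      rw [← h0]
      gcongr
      all_goals exact truncPow_le hp ht
    refine (abs_sub_le_of_nonneg_of_le (by positivity) h2 (by positivity) le_rfl).trans ?_
    exact Real.rpow_le_rpow ht.le hδt (by linarith)

end Scalar

/-! ### Factorization through powers of a dominating positive element -/

section Factor

open Filter Topology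

variable {A : Type*} [NonUnitalCStarAlgebra A] [PartialOrder A] [StarOrderedRing A]

@[simp]
theorem star_nnrpow (a : A) (q : ℝ≥0) : star (a ^ q) = a ^ q :=
  CFC.nnrpow_nonneg.isSelfAdjoint.star_eq

@[simp]
theorem star_sqrt (a : A) : star (CFC.sqrt a) = CFC.sqrt a :=
  (CFC.sqrt_nonneg a).isSelfAdjoint.star_eq

theorem sqrt_mul_mul_sqrt {a : A} (ha : 0 ≤ a) : CFC.sqrt a * a * CFC.sqrt a = a * a := by
  set s := CFC.sqrt a
  rw [← CFC.sqrt_mul_sqrt_self a ha]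
  simp only [mul_assoc, s]

/-- Operator inequalities bound `x * c` by functional calculus in `b`. -/
theorem norm_mul_le_of_star_mul_self_le {x b : A} (h : star x * x ≤ b) (c : A) :
    ‖x * c‖ ≤ ‖CFC.sqrt b * c‖ := by
  have hb : 0 ≤ b := (star_mul_self_nonneg x).trans h
  have h1 : star (x * c) * (x * c) ≤ star (CFC.sqrt b * c) * (CFC.sqrt b * c) := by
    have h2 : star (CFC.sqrt b) = CFC.sqrt b := (CFC.sqrt_nonneg b).isSelfAdjoint.star_eq
    have h3 : star (CFC.sqrt b * c) * (CFC.sqrt b * c) = star c * b * c := by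
      rw [star_mul, h2, mul_assoc, ← mul_assoc (CFC.sqrt b), CFC.sqrt_mul_sqrt_self b, mul_assoc]
    have h4 : star (x * c) * (x * c) = star c * (star x * x) * c := by
      simp only [star_mul, mul_assoc]
    rw [h3, h4]
    exact star_left_conjugate_le_conjugate h c
  have h5 := CStarAlgebra.norm_le_norm_of_nonneg_of_le (star_mul_self_nonneg _) h1
  rw [CStarRing.norm_star_mul_self, CStarRing.norm_star_mul_self] at h5
  exact le_of_sq_le_sq (by simpa [sq] using h5) (norm_nonneg _)

/-- All positive powers of a positive element have the same right annihilator: the exponent can be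
halved by the C⋆-identity, and raised by multiplication. -/
theorem nnrpow_mul_eq_zero_of_nnrpow_mul_eq_zero {s z : A} {p q : ℝ≥0} (hp : 0 < p) (hq : 0 < q)
    (h : s ^ p * z = 0) : s ^ q * z = 0 := by
  have key : ∀ n : ℕ, s ^ (p / 2 ^ n) * z = 0 := by
    intro n
    induction n with
    | zero => simpa using h
    | succ n ih =>
      set r := p / 2 ^ (n + 1) with hr
      have hr0 : 0 < r := by positivity
      have hrr : p / 2 ^ n = r + r := by rw [hr, pow_succ]; field_simp; norm_num
      rw [hrr, CFC.nnrpow_add hr0 hr0, mul_assoc] at ih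
      rw [← CStarRing.star_mul_self_eq_zero_iff, star_mul, star_nnrpow, mul_assoc, ih, mul_zero]
  obtain ⟨n, hn⟩ := exists_pow_lt_of_lt_one (div_pos hq hp) (by norm_num : (1 / 2 : ℝ≥0) < 1)
  have hlt : p / 2 ^ n < q := by
    rw [lt_div_iff₀ hp] at hn
    convert hn using 1
    rw [one_div, inv_pow]; field_simp
  rw [← tsub_add_cancel_of_le hlt.le, CFC.nnrpow_add (tsub_pos_of_lt hlt) (by positivity),
    mul_assoc, key, mul_zero]

/-- If `star x * x ≤ b` and `p < 1 / 2`, then `x = u * b ^ p` for some `u`, a substitute for the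
polar decomposition which stays inside the algebra. Formally `u = x * b ^ (-p)`; it is constructed
as the limit of `x * g b`, where `g` runs through truncations of `t ^ (-p)`. If `star x * x = b`,
the formal identity `star u * u = b ^ (1 - 2 * p)` holds too. -/
theorem exists_eq_mul_nnrpow {x b : A} (h : star x * x ≤ b) {p : ℝ≥0} (hp : 0 < p)
    (hp' : p < 1 / 2) :
    ∃ u : A, x = u * b ^ p ∧ (star x * x = b → star u * u = b ^ (1 - 2 * p)) := by
  have hb : 0 ≤ b := (star_mul_self_nonneg x).trans h
  have hpR : (0 : ℝ) ≤ p := p.2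
  have hpR' : (p : ℝ) < 1 / 2 := by exact_mod_cast hp'
  have hspec : ∀ t ∈ quasispectrum ℝ b, 0 ≤ t := quasispectrum_nonneg_of_nonneg b hb
  let δ : ℕ → ℝ := fun n => 1 / ((n : ℝ) + 1)
  have hδ : ∀ n, 0 < δ n := fun n => by positivity
  have hδanti : Antitone δ := fun m n hmn => by dsimp only [δ]; gcongr
  have hδlim : Tendsto δ atTop (𝓝 0) := tendsto_one_div_add_atTop_nhds_zero_nat
  have hcont : ∀ n, Continuous (truncPow p (δ n)) := fun n => continuous_truncPow (hδ n)
  let g : ℕ → A := fun n => cfcₙ (truncPow p (δ n)) b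
  have hg : ∀ n, IsSelfAdjoint (g n) := fun n => cfcₙ_predicate _ _
  have hsqrt : CFC.sqrt b = cfcₙ Real.sqrt b := CFC.sqrt_eq_real_sqrt b
  have hpow : b ^ p = cfcₙ (fun t : ℝ => t ^ (p : ℝ)) b := CFC.nnrpow_eq_cfcₙ_real b p
  have hpc : Continuous fun t : ℝ => t ^ (p : ℝ) := Real.continuous_rpow_const hpR
  have hlim : ∀ q : ℝ, 0 < q → Tendsto (fun n => δ n ^ q) atTop (𝓝 0) := fun q hq => by
    simpa [Real.zero_rpow hq.ne'] using hδlim.rpow_const (Or.inr hq.le)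
  have hcauchy : CauchySeq fun n => x * g n := by
    refine cauchySeq_of_le_tendsto_0 (fun N => δ N ^ (1 / 2 - (p : ℝ))) (fun n m N hn hm => ?_)
      (hlim _ (by linarith))
    rw [dist_eq_norm, ← mul_sub]
    refine (norm_mul_le_of_star_mul_self_le h _).trans ?_
    rw [hsqrt, ← cfcₙ_sub (truncPow p (δ n)) (truncPow p (δ m)) b (hcont n).continuousOn
      truncPow_zero (hcont m).continuousOn truncPow_zero,
      ← cfcₙ_mul Real.sqrt (fun t => truncPow p (δ n) t - truncPow p (δ m) t) b
      Real.continuous_sqrt.continuousOn (by simp)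
      ((hcont n).sub (hcont m)).continuousOn (by simp [truncPow_zero])]
    exact norm_cfcₙ_le fun t ht => abs_sqrt_mul_truncPow_sub_le hpR hpR' (hδ n) (hδ m)
      (hδanti hn) (hδanti hm) (hspec t ht)
  obtain ⟨u, hu⟩ := cauchySeq_tendsto_of_complete hcauchy
  -- There is no unit to compare `g n * b ^ p` with, so first compare after multiplying by `b`.
  have hub : u * b ^ p * b = x * b := by
    have h1 : Tendsto (fun n => x * g n * b ^ p * b) atTop (𝓝 (u * b ^ p * b)) :=
      (hu.mul_const _).mul_const _
    refine tendsto_nhds_unique h1 (tendsto_iff_norm_sub_tendsto_zero.2 ?_)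
    have h2 : Tendsto (fun n => √(δ n) * δ n) atTop (𝓝 0) := by
      simpa using (Real.continuous_sqrt.tendsto 0 |>.comp hδlim).mul hδlim
    refine squeeze_zero (fun _ => norm_nonneg _) (fun n => ?_) h2
    have h3 : x * g n * b ^ p * b - x * b = x * (g n * (b ^ p * b) - b) := by
      simp only [mul_sub, mul_assoc]
    rw [h3]
    refine (norm_mul_le_of_star_mul_self_le h _).trans ?_
    have h4 : g n * (b ^ p * b) - b = cfcₙ (fun t : ℝ =>
        truncPow p (δ n) t * (t ^ (p : ℝ) * t) - t) b := by
      have hc : Continuous fun t : ℝ => t ^ (p : ℝ) * t := hpc.mul continuous_id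
      rw [cfcₙ_sub (fun t => truncPow p (δ n) t * (t ^ (p : ℝ) * t)) (fun t => t) b
          ((hcont n).mul hc).continuousOn (by simp) continuousOn_id rfl,
        cfcₙ_mul (truncPow p (δ n)) (fun t => t ^ (p : ℝ) * t) b (hcont n).continuousOn
          truncPow_zero hc.continuousOn (by simp),
        cfcₙ_mul (fun t => t ^ (p : ℝ)) (fun t => t) b hpc.continuousOn
          (Real.zero_rpow (NNReal.coe_ne_zero.2 hp.ne')) continuousOn_id rfl,
        ← hpow, cfcₙ_id' ℝ b]
    rw [h4, hsqrt, ← cfcₙ_mul Real.sqrt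
      (fun t => truncPow p (δ n) t * (t ^ (p : ℝ) * t) - t) b
      Real.continuous_sqrt.continuousOn (by simp)
      (((hcont n).mul (hpc.mul continuous_id)).sub continuous_id).continuousOn (by simp)]
    exact norm_cfcₙ_le fun t ht => abs_sqrt_mul_truncPow_mul_sub_le hpR (hδ n) (hspec t ht)
  refine ⟨u, ?_, fun hxb => ?_⟩
  · -- `w * b = 0` implies `w * star x = 0` and `w * b ^ p = 0`, hence `w * star w = 0`.
    set w := x - u * b ^ p with hw
    have hwb : w * b = 0 := by rw [hw, sub_mul, hub, sub_self]
    have hwx : w * star x = 0 := by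
      have h1 : w * (star x * x) * star w ≤ w * b * star w :=
        star_right_conjugate_le_conjugate h w
      rw [hwb, zero_mul] at h1
      have h2 : (w * star x) * star (w * star x) ≤ 0 := by
        simpa only [star_mul, star_star, mul_assoc] using h1
      have h3 := le_antisymm h2 (mul_star_self_nonneg _)
      exact CStarRing.mul_star_self_eq_zero_iff _ |>.1 h3
    have hwp : w * b ^ p = 0 := by
      have h1 : b ^ (1 : ℝ≥0) * star w = 0 := by
        rw [CFC.nnrpow_one b, ← hb.isSelfAdjoint.star_eq, ← star_mul, hwb, star_zero]
      have h2 := nnrpow_mul_eq_zero_of_nnrpow_mul_eq_zero one_pos hp h1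
      rw [← star_eq_zero, star_mul, star_nnrpow, h2]
    have hww : w * star w = 0 := by
      nth_rewrite 2 [hw]
      rw [star_sub, star_mul, star_nnrpow, mul_sub, hwx, ← mul_assoc,
        hwp, zero_mul, sub_zero]
    exact sub_eq_zero.1 ((CStarRing.mul_star_self_eq_zero_iff _).1 hww)
  · have h1 : Tendsto (fun n => star (x * g n) * (x * g n)) atTop (𝓝 (star u * u)) :=
      hu.star.mul hu
    refine tendsto_nhds_unique h1 (tendsto_iff_norm_sub_tendsto_zero.2 ?_)
    refine squeeze_zero (fun _ => norm_nonneg _) (fun n => ?_) (hlim (1 - 2 * p) (by linarith))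
    have h3 : ((1 - 2 * p : ℝ≥0) : ℝ) = 1 - 2 * (p : ℝ) := by
      rw [NNReal.coe_sub]
      · simp
      · have : (2 * p : ℝ) ≤ 1 := by linarith
        exact_mod_cast this
    have hq : (0 : ℝ) < 1 - 2 * (p : ℝ) := by linarith
    have h2 : star (x * g n) * (x * g n) - b ^ (1 - 2 * p) = cfcₙ (fun t : ℝ =>
        truncPow p (δ n) t * (t * truncPow p (δ n) t) - t ^ (1 - 2 * (p : ℝ))) b := by
      have hc : Continuous fun t : ℝ => t ^ (1 - 2 * (p : ℝ)) := Real.continuous_rpow_const hq.le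
      have h4 : star (x * g n) * (x * g n) = g n * (b * g n) := by
        rw [star_mul, (hg n).star_eq, mul_assoc, ← mul_assoc (star x), hxb]
      rw [cfcₙ_sub (fun t => truncPow p (δ n) t * (t * truncPow p (δ n) t))
          (fun t => t ^ (1 - 2 * (p : ℝ))) b
          ((hcont n).mul (continuous_id.mul (hcont n))).continuousOn
        (by simp [truncPow_zero]) hc.continuousOn (Real.zero_rpow hq.ne'),
        cfcₙ_mul (truncPow p (δ n)) (fun t => t * truncPow p (δ n) t) b
          (hcont n).continuousOn truncPow_zero (continuous_id.mul (hcont n)).continuousOn (by simp),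
        cfcₙ_mul (fun t => t) (truncPow p (δ n)) b continuousOn_id rfl (hcont n).continuousOn
          truncPow_zero,
        cfcₙ_id' ℝ b, h4, CFC.nnrpow_eq_cfcₙ_real b _, h3]
    rw [h2]
    exact norm_cfcₙ_le fun t ht => abs_truncPow_mul_mul_sub_le hpR hpR' (hδ n) (hspec t ht)

end Factor

end CStarAlgebra

namespace CStarAlgebra

/-! ### Cancellation, and roots of `star x * x` and `x * star x` -/

section Cancel

variable {A : Type*} [NonUnitalCStarAlgebra A] [PartialOrder A] [StarOrderedRing A]

/-- From `s = s ^ β * m * s ^ β` one would like to conclude `m = s ^ (1 - 2 * β)`. This holds after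
multiplication from both sides by an arbitrarily small power of `s`. -/
theorem conj_nnrpow_eq_of_eq_conj {s m : A} {β γ r : ℝ≥0} (hs : 0 ≤ s) (hβ : 0 < β) (hγ : 0 < γ)
    (hr : 0 < r) (h1 : r + 2 * β = 1) (h : s = s ^ β * m * s ^ β) :
    s ^ (r + 2 * γ) = s ^ γ * m * s ^ γ := by
  have hexp : ∀ δ : ℝ≥0, 0 < δ → s ^ (r + 2 * δ) = s ^ δ * s ^ r * s ^ δ := fun δ hδ => by
    rw [← CFC.nnrpow_add hδ hr, ← CFC.nnrpow_add (by positivity) hδ]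
    congr 1; ring
  have h2 : s ^ β * ((s ^ r - m) * s ^ β) = 0 := by
    rw [sub_mul, mul_sub, ← mul_assoc, ← mul_assoc, ← hexp β hβ, ← h, h1, CFC.nnrpow_one s,
      sub_self]
  have h3 := nnrpow_mul_eq_zero_of_nnrpow_mul_eq_zero hβ hγ h2
  have h4 : s ^ β * (star (s ^ r - m) * s ^ γ) = 0 := by
    rw [← star_eq_zero, star_mul, star_mul, star_star, star_nnrpow, star_nnrpow, mul_assoc, h3]
  have h5 := nnrpow_mul_eq_zero_of_nnrpow_mul_eq_zero hβ hγ h4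
  have h6 : s ^ γ * (s ^ r - m) * s ^ γ = 0 := by
    rw [← star_eq_zero, star_mul, star_mul, star_nnrpow, h5]
  rw [hexp γ hγ, ← sub_eq_zero, ← sub_mul, ← mul_sub, h6]

/-- A single `y` realizes the same small root of `star x * x` and of `x * star x`. Cube roots are
the convenient ones: if `x = y * star y * y`, then `star x * x = (star y * y) ^ 3` and
`x * star x = (y * star y) ^ 3`. -/
theorem exists_root_three_pow (x : A) (k : ℕ) :
    ∃ y : A, star y * y = (star x * x) ^ ((3 : ℝ≥0)⁻¹ ^ k) ∧
      y * star y = (x * star x) ^ ((3 : ℝ≥0)⁻¹ ^ k) := by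
  induction k with
  | zero =>
    refine ⟨x, ?_, ?_⟩
    · rw [pow_zero, CFC.nnrpow_one _ (star_mul_self_nonneg x)]
    · rw [pow_zero, CFC.nnrpow_one _ (mul_star_self_nonneg x)]
  | succ k ih =>
    obtain ⟨y, hy, hy'⟩ := ih
    obtain ⟨u, hu, hu'⟩ := exists_eq_mul_nnrpow (x := y) le_rfl (p := 3⁻¹) (by norm_num)
      (by rw [one_div]; gcongr; norm_num)
    have h3 : star u * u = (star y * y) ^ (3⁻¹ : ℝ≥0) := by
      rw [hu' rfl]
      congr 1
      rw [tsub_eq_iff_eq_add_of_le]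
      · ext; push_cast; norm_num
      · rw [← NNReal.coe_le_coe]; push_cast; norm_num
    refine ⟨u, ?_, ?_⟩
    · rw [h3, hy, CFC.nnrpow_nnrpow, pow_succ]
    · rw [pow_succ, ← CFC.nnrpow_nnrpow, ← hy', eq_comm,
        CFC.nnrpow_inv_eq _ _ (by norm_num) (mul_star_self_nonneg y) (mul_star_self_nonneg u),
        CFC.nnrpow_three _ (mul_star_self_nonneg u)]
      have hy3 : y = u * (star u * u) := by rw [h3]; exact hu
      conv_rhs => rw [hy3]
      simp only [star_mul, star_star, mul_assoc]

theorem nnrpow_mul_star_self_add_two (y : A) (n : ℕ) :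
    (y * star y) ^ ((n + 2 : ℕ) : ℝ≥0) = y * (star y * y) ^ ((n + 1 : ℕ) : ℝ≥0) * star y := by
  have h0 := mul_star_self_nonneg y
  have h1 := star_mul_self_nonneg y
  induction n with
  | zero =>
    simp only [zero_add, Nat.cast_one, Nat.cast_ofNat]
    rw [CFC.nnrpow_one _ h1, CFC.nnrpow_two _ h0]
    simp only [mul_assoc]
  | succ n ih =>
    rw [show n + 1 + 2 = (n + 2) + 1 from rfl, Nat.cast_succ, CFC.nnrpow_add (by positivity)
      one_pos, ih, CFC.nnrpow_one _ h0, Nat.cast_succ (n + 1), CFC.nnrpow_add (by positivity)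
      one_pos, CFC.nnrpow_one _ h1]
    simp only [mul_assoc]

end Cancel

end CStarAlgebra

/-! ### Powers of positive elements lying in an ideal -/

namespace TwoSidedIdeal

section PowerMem

variable {A : Type*} [NonUnitalCStarAlgebra A] [PartialOrder A] [StarOrderedRing A]
  {I : TwoSidedIdeal A}

open CStarAlgebra

theorem nnrpow_mem_of_le {a : A} {p q : ℝ≥0} (hp : 0 < p) (hpq : p ≤ q) (h : a ^ p ∈ I) :
    a ^ q ∈ I := by
  rcases hpq.eq_or_lt with rfl | hlt
  · exact h
  · rw [← tsub_add_cancel_of_le hpq, CFC.nnrpow_add (tsub_pos_of_lt hlt) hp]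
    exact I.mul_mem_left _ _ h

/-- Membership of powers in an arbitrary ideal is hereditary, at the price of enlarging the
exponent. -/
theorem nnrpow_mem_of_le_of_nnrpow_mem {a b : A} {p q : ℝ≥0} (hab : a ≤ b) (hp : 0 < p)
    (hpq : p < q) (hq : q ≤ 1) (h : b ^ p ∈ I) : a ^ q ∈ I := by
  have hq0 : 0 < q := hp.trans hpq
  have hxx : a ^ (q / 2) * a ^ (q / 2) = a ^ q := by
    rw [← CFC.nnrpow_add (by positivity) (by positivity), add_halves]
  have hle : star (a ^ (q / 2)) * a ^ (q / 2) ≤ b ^ q := by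
    rw [star_nnrpow, hxx]
    exact CFC.nnrpow_le_nnrpow ⟨zero_le, hq⟩ hab
  obtain ⟨u, hu, -⟩ := exists_eq_mul_nnrpow hle (p := p / q / 2) (by positivity)
    (by gcongr; exact (div_lt_one hq0).2 hpq)
  have he : q * (p / q / 2) = p / 2 := by field_simp
  rw [CFC.nnrpow_nnrpow, he] at hu
  have h2 : a ^ (q / 2) = b ^ (p / 2) * star u := by
    rw [← star_nnrpow a, hu, star_mul, star_nnrpow]
  have h3 : a ^ q = u * (b ^ p) * star u := by
    rw [← hxx]
    nth_rewrite 1 [hu]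
    rw [h2, mul_assoc, ← mul_assoc (b ^ _), ← CFC.nnrpow_add (by positivity) (by positivity),
      add_halves, mul_assoc]
  rw [h3]
  exact I.mul_mem_right _ _ (I.mul_mem_left _ _ h)

/-- If `a ≤ s`, a factor `s ^ β` can be extracted from both sides of `a` while a power `a ^ p`
remains in the middle: write `a = a ^ (c / 2) * a ^ p * a ^ (c / 2)` with `c = 1 - p` and factor
`a ^ (c / 2)` through `s ^ c ≥ a ^ c`. -/
theorem exists_mem_eq_conj_nnrpow {a s : A} {p r β : ℝ≥0} (ha : 0 ≤ a) (has : a ≤ s)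
    (hp : 0 < p) (hpr : p < r) (hβ : 0 < β) (hβr : r + 2 * β = 1) (h : a ^ p ∈ I) :
    ∃ m ∈ I, a = s ^ β * m * s ^ β := by
  obtain ⟨c, hc⟩ : ∃ c, p + c = 1 :=
    ⟨1 - p, add_tsub_cancel_of_le ((hpr.le.trans le_self_add).trans_eq hβr)⟩
  have h2βc : 2 * β < c := by
    rw [← add_lt_add_iff_left p, hc, ← hβr]
    gcongr
  have hc0 : 0 < c := lt_of_le_of_lt zero_le h2βc
  have hle : star (a ^ (c / 2)) * a ^ (c / 2) ≤ s ^ c := by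
    rw [star_nnrpow, ← CFC.nnrpow_add (by positivity) (by positivity), add_halves]
    exact CFC.nnrpow_le_nnrpow ⟨zero_le, le_add_self.trans_eq hc⟩ has
  obtain ⟨w, hw, -⟩ := exists_eq_mul_nnrpow hle (p := β / c) (by positivity)
    (by rw [div_lt_div_iff₀ hc0 two_pos]; linarith)
  rw [CFC.nnrpow_nnrpow, mul_div_cancel₀ _ hc0.ne'] at hw
  refine ⟨star w * a ^ p * w, I.mul_mem_right _ _ (I.mul_mem_left _ _ h), ?_⟩
  have h1 : a = a ^ (c / 2) * a ^ p * a ^ (c / 2) := by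
    rw [← CFC.nnrpow_add (by positivity) hp, ← CFC.nnrpow_add (by positivity) (by positivity)]
    have : c / 2 + p + c / 2 = 1 := by rw [← hc]; ring
    rw [this, CFC.nnrpow_one a]
  have h2 : a ^ (c / 2) = s ^ β * star w := by rw [← star_nnrpow a, hw, star_mul, star_nnrpow]
  nth_rewrite 1 [h1]
  nth_rewrite 1 [h2]
  rw [hw]
  simp only [mul_assoc]

/-- Membership of powers in an arbitrary ideal is stable under sums, at the price of enlarging the
exponent. With `s = a + b`, both summands have the form `s ^ β * m * s ^ β` with `m ∈ I`, and
cancelling `s ^ β` exhibits `s ^ q` as a multiple of an element of `I`. -/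
theorem add_nnrpow_mem {a b : A} {p q : ℝ≥0} (ha : 0 ≤ a) (hb : 0 ≤ b) (hp : 0 < p)
    (hpq : p < q) (hq : q ≤ 1) (hap : a ^ p ∈ I) (hbp : b ^ p ∈ I) : (a + b) ^ q ∈ I := by
  -- The room between `p` and `q` is used twice: `p < r` to factor, `r < q` to cancel.
  obtain ⟨r, hpr, hrq⟩ := exists_between hpq
  obtain ⟨β, hβ⟩ : ∃ β, r + 2 * β = 1 :=
    ⟨(1 - r) / 2, by rw [mul_div_cancel₀ _ two_ne_zero,
      add_tsub_cancel_of_le (hrq.le.trans hq)]⟩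
  obtain ⟨γ, hγ⟩ : ∃ γ, r + 2 * γ = q :=
    ⟨(q - r) / 2, by rw [mul_div_cancel₀ _ two_ne_zero, add_tsub_cancel_of_le hrq.le]⟩
  have hβ0 : 0 < β := by
    rw [pos_iff_ne_zero]; rintro rfl
    simp only [mul_zero, add_zero] at hβ
    exact absurd (hrq.trans_le hq) (by simp [hβ])
  have hγ0 : 0 < γ := by
    rw [pos_iff_ne_zero]; rintro rfl
    simp only [mul_zero, add_zero] at hγ
    exact hrq.ne hγ
  obtain ⟨m, hm, hma⟩ := exists_mem_eq_conj_nnrpow ha (le_add_of_nonneg_right hb) hp hpr hβ0 hβ hap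
  obtain ⟨n, hn, hnb⟩ := exists_mem_eq_conj_nnrpow hb (le_add_of_nonneg_left ha) hp hpr hβ0 hβ hbp
  have hs : a + b = (a + b) ^ β * (m + n) * (a + b) ^ β := by
    rw [mul_add, add_mul, ← hma, ← hnb]
  rw [← hγ, conj_nnrpow_eq_of_eq_conj (add_nonneg ha hb) hβ0 hγ0 (hp.trans hpr) hβ hs]
  exact I.mul_mem_right _ _ (I.mul_mem_left _ _ (I.add_mem hm hn))

/-- Membership of powers in an arbitrary ideal passes from `star x * x` to `x * star x`, at the
price of enlarging the exponent. -/
theorem mul_star_self_nnrpow_mem {x : A} {p q : ℝ≥0} (hp : 0 < p) (hpq : p < q)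
    (h : (star x * x) ^ p ∈ I) : (x * star x) ^ q ∈ I := by
  obtain ⟨k, hk⟩ := exists_pow_lt_of_lt_one (div_pos (tsub_pos_of_lt hpq) two_pos)
    (by rw [inv_lt_one_iff₀]; right; norm_num : (3 : ℝ≥0)⁻¹ < 1)
  set ε : ℝ≥0 := 3⁻¹ ^ k with hε
  have hε0 : 0 < ε := by positivity
  obtain ⟨y, hy, hy'⟩ := exists_root_three_pow x k
  set n : ℕ := ⌊p / ε⌋₊ with hn
  have h1 : p ≤ ε * ((n + 1 : ℕ) : ℝ≥0) := by
    rw [mul_comm, ← div_le_iff₀ hε0]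
    exact_mod_cast (Nat.lt_floor_add_one (p / ε)).le
  have h2 : ε * ((n + 2 : ℕ) : ℝ≥0) ≤ q := by
    have h3 : (n : ℝ≥0) * ε ≤ p := (le_div_iff₀ hε0).1 (Nat.floor_le zero_le)
    have h4 : ε * 2 < q - p := (lt_div_iff₀ two_pos).1 hk
    calc ε * ((n + 2 : ℕ) : ℝ≥0) = n * ε + ε * 2 := by push_cast; ring
      _ ≤ p + (q - p) := add_le_add h3 h4.le
      _ = q := add_tsub_cancel_of_le hpq.le
  refine nnrpow_mem_of_le (by positivity) h2 ?_
  rw [← CFC.nnrpow_nnrpow, ← hy', nnrpow_mul_star_self_add_two, hy, CFC.nnrpow_nnrpow]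
  exact I.mul_mem_right _ _ (I.mul_mem_left _ _ (nnrpow_mem_of_le hp h1 h))

end PowerMem

end TwoSidedIdeal

/-! ### Dixmier cones and the ideals they span -/

namespace CStarAlgebra

section DixmierCone

variable {A : Type*} [NonUnitalCStarAlgebra A] [PartialOrder A] [StarOrderedRing A]

/-- A strongly invariant hereditary set of positive elements closed under addition: the possible
positive parts of Dixmier ideals. Stability under nonnegative scalars follows from heredity, and the
one implication required between `star x * x` and `x * star x` yields the other one on replacing `x`
by `star x`. -/
structure IsDixmierCone (P : Set A) : Prop where
  nonneg : ∀ a ∈ P, 0 ≤ a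
  zero_mem : 0 ∈ P
  add_mem : ∀ a ∈ P, ∀ b ∈ P, a + b ∈ P
  hereditary : ∀ a, ∀ b ∈ P, 0 ≤ a → a ≤ b → a ∈ P
  mul_star_self_mem : ∀ x : A, star x * x ∈ P → x * star x ∈ P

namespace IsDixmierCone

variable {P : Set A}

theorem smul_mem (hP : IsDixmierCone P) {a : A} (ha : a ∈ P) {r : ℝ} (hr : 0 ≤ r) :
    r • a ∈ P := by
  have hn : ∀ n : ℕ, (n : ℝ) • a ∈ P := by
    intro n
    induction n with
    | zero => simpa using hP.zero_mem
    | succ n ih =>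
      rw [Nat.cast_succ, add_smul, one_smul]
      exact hP.add_mem _ ih _ ha
  obtain ⟨n, hn'⟩ := exists_nat_ge r
  have ha0 := hP.nonneg a ha
  exact hP.hereditary _ _ (hn n) (smul_nonneg hr ha0) (smul_le_smul_of_nonneg_right hn' ha0)

theorem conj_mem (hP : IsDixmierCone P) {a : A} (ha : a ∈ P) (c : A) : c * a * star c ∈ P := by
  have ha0 := hP.nonneg a ha
  have h1 : star (c * CFC.sqrt a) * (c * CFC.sqrt a) ∈ P := by
    refine hP.hereditary _ _ (hP.smul_mem ha (norm_nonneg (star c * c)))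
      (star_mul_self_nonneg _) ?_
    have h2 := star_left_conjugate_le_norm_smul (a := CFC.sqrt a) (b := star c * c)
      (IsSelfAdjoint.star_mul_self c)
    rw [star_sqrt, CFC.sqrt_mul_sqrt_self a] at h2
    simpa only [star_mul, star_sqrt, mul_assoc] using h2
  have h3 := hP.mul_star_self_mem _ h1
  rwa [star_mul, star_sqrt, mul_assoc, ← mul_assoc (CFC.sqrt a), CFC.sqrt_mul_sqrt_self a,
    ← mul_assoc] at h3

/-- The subspace of all `z` with `star z * z ∈ P`, the analogue of the space of Hilbert-Schmidt
operators. -/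
def sqSubmodule (hP : IsDixmierCone P) : Submodule ℂ A where
  carrier := {z | star z * z ∈ P}
  zero_mem' := by simpa using hP.zero_mem
  add_mem' := by
    intro z w hz hw
    have hsum := hP.smul_mem (hP.add_mem _ hz _ hw) zero_le_two
    refine hP.hereditary _ _ hsum (star_mul_self_nonneg _) ?_
    -- `star (z + w) * (z + w) + star (z - w) * (z - w) = 2 * (star z * z + star w * w)`
    have h := star_mul_self_nonneg (z - w)
    rw [← sub_nonneg]
    convert h using 1
    rw [two_smul]
    simp only [star_add, star_sub, add_mul, mul_add, sub_mul, mul_sub]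
    abel
  smul_mem' := by
    intro c z hz
    have h : star (c • z) * (c • z) = (‖c‖ ^ 2) • (star z * z) := by
      rw [star_smul, smul_mul_assoc, mul_smul_comm, smul_smul, ← Complex.coe_smul]
      congr 1
      rw [Complex.star_def, ← Complex.normSq_eq_conj_mul_self, Complex.normSq_eq_norm_sq]
    change star (c • z) * (c • z) ∈ P
    rw [h]
    exact hP.smul_mem hz (by positivity)

theorem mem_sqSubmodule (hP : IsDixmierCone P) {z : A} :
    z ∈ hP.sqSubmodule ↔ star z * z ∈ P := Iff.rfl

theorem star_mem_sqSubmodule (hP : IsDixmierCone P) {z : A} (hz : z ∈ hP.sqSubmodule) :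
    star z ∈ hP.sqSubmodule := by
  rw [mem_sqSubmodule, star_star]
  exact hP.mul_star_self_mem _ hz

/-- By polarization, `star y * z` is a combination of four elements `star t * t` of `P`. -/
theorem star_mul_mem_span (hP : IsDixmierCone P) {y z : A} (hy : y ∈ hP.sqSubmodule)
    (hz : z ∈ hP.sqSubmodule) : star y * z ∈ Submodule.span ℂ P := by
  have key : ∀ c : ℂ, star (z + c • y) * (z + c • y) ∈ Submodule.span ℂ P := fun c =>
    Submodule.subset_span (hP.sqSubmodule.add_mem hz (hP.sqSubmodule.smul_mem c hy))
  have hpol : star y * z = (1 / 4 : ℂ) • ((1 : ℂ) • (star (z + (1 : ℂ) • y) * (z + (1 : ℂ) • y))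
      + Complex.I • (star (z + Complex.I • y) * (z + Complex.I • y))
      + (-1 : ℂ) • (star (z + (-1 : ℂ) • y) * (z + (-1 : ℂ) • y))
      + (-Complex.I) • (star (z + (-Complex.I) • y) * (z + (-Complex.I) • y))) := by
    simp only [star_add, star_smul, add_mul, mul_add, smul_mul_assoc, mul_smul_comm, smul_add,
      smul_smul, Complex.star_def, map_neg, map_one, Complex.conj_I]
    match_scalars <;> ring_nf <;> simp <;> norm_num
  rw [hpol]
  exact Submodule.smul_mem _ _ (Submodule.add_mem _ (Submodule.add_mem _ (Submodule.add_mem _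
    (Submodule.smul_mem _ _ (key _)) (Submodule.smul_mem _ _ (key _)))
    (Submodule.smul_mem _ _ (key _))) (Submodule.smul_mem _ _ (key _)))

theorem mul_mem_span (hP : IsDixmierCone P) {y z : A} (hy : y ∈ hP.sqSubmodule)
    (hz : z ∈ hP.sqSubmodule) : y * z ∈ Submodule.span ℂ P := by
  simpa using hP.star_mul_mem_span (hP.star_mem_sqSubmodule hy) hz

theorem mul_mem_span_of_mem (hP : IsDixmierCone P) {a : A} (ha : a ∈ P) (c : A) :
    c * a ∈ Submodule.span ℂ P ∧ a * c ∈ Submodule.span ℂ P := by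
  have ha0 := hP.nonneg a ha
  have h1 : CFC.sqrt a ∈ hP.sqSubmodule := by
    rwa [mem_sqSubmodule, star_sqrt, CFC.sqrt_mul_sqrt_self a]
  have h2 : ∀ d : A, CFC.sqrt a * d ∈ hP.sqSubmodule := by
    intro d
    have := hP.conj_mem ha (star d)
    rw [mem_sqSubmodule, star_mul, star_sqrt, mul_assoc, ← mul_assoc (CFC.sqrt a),
      CFC.sqrt_mul_sqrt_self a]
    simpa [mul_assoc] using this
  constructor
  · have := hP.star_mul_mem_span (h2 (star c)) h1
    rwa [star_mul, star_star, star_sqrt, mul_assoc, CFC.sqrt_mul_sqrt_self a] at this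
  · have := hP.mul_mem_span h1 (h2 c)
    rwa [← mul_assoc, CFC.sqrt_mul_sqrt_self a] at this

/-- The two-sided ideal of `A` whose underlying set is the complex linear span of a Dixmier cone. -/
def toIdeal (hP : IsDixmierCone P) : TwoSidedIdeal A :=
  TwoSidedIdeal.mk' (Submodule.span ℂ P : Set A) (Submodule.zero_mem _)
    (fun hx hy => Submodule.add_mem _ hx hy) (fun hx => Submodule.neg_mem _ hx)
    (by
      intro c x hx
      induction hx using Submodule.span_induction with
      | mem a ha => exact (hP.mul_mem_span_of_mem ha c).1
      | zero => simp
      | add x y _ _ hx hy => rw [mul_add]; exact Submodule.add_mem _ hx hy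
      | smul r x _ hx => rw [mul_smul_comm]; exact Submodule.smul_mem _ _ hx)
    (by
      intro x c hx
      induction hx using Submodule.span_induction with
      | mem a ha => exact (hP.mul_mem_span_of_mem ha c).2
      | zero => simp
      | add x y _ _ hx hy => rw [add_mul]; exact Submodule.add_mem _ hx hy
      | smul r x _ hx => rw [smul_mul_assoc]; exact Submodule.smul_mem _ _ hx)

theorem mem_toIdeal (hP : IsDixmierCone P) {x : A} : x ∈ hP.toIdeal ↔ x ∈ Submodule.span ℂ P :=
  TwoSidedIdeal.mem_mk' _ _ _ _ _ _ x

/-- Twice the real part of an element of the span of `P` is dominated by an element of `P`. -/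
theorem exists_add_star_le (hP : IsDixmierCone P) {x : A} (hx : x ∈ Submodule.span ℂ P) :
    ∃ b ∈ P, x + star x ≤ b := by
  have aux : ∀ (a : A), a ∈ P → ∀ c : ℂ, ∃ b ∈ P, c • a + star (c • a) ≤ b := by
    intro a ha c
    have ha0 := hP.nonneg a ha
    refine ⟨(2 * ‖c‖) • a, hP.smul_mem ha (by positivity), ?_⟩
    have h : c • a + star (c • a) = (2 * c.re) • a := by
      rw [star_smul, ha0.isSelfAdjoint.star_eq, ← add_smul, ← Complex.coe_smul]
      congr 1
      rw [Complex.star_def, Complex.add_conj]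
    rw [h]
    refine smul_le_smul_of_nonneg_right ?_ ha0
    gcongr
    exact Complex.re_le_norm c
  induction hx using Submodule.closure_induction with
  | zero => exact ⟨0, hP.zero_mem, by simp⟩
  | add x y _ _ hx hy =>
    obtain ⟨b, hb, hxb⟩ := hx
    obtain ⟨c, hc, hyc⟩ := hy
    refine ⟨b + c, hP.add_mem _ hb _ hc, ?_⟩
    rw [star_add, add_add_add_comm]
    exact add_le_add hxb hyc
  | smul_mem r x hx => exact aux x hx r

theorem mem_of_add_star_le (hP : IsDixmierCone P) {a b : A} (hb : b ∈ P) (ha : 0 ≤ a)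
    (h : a + star a ≤ b) : a ∈ P := by
  refine hP.hereditary _ _ hb ha (le_trans ?_ h)
  rw [ha.isSelfAdjoint.star_eq]
  exact le_add_of_nonneg_left ha

theorem mem_toIdeal_iff_of_nonneg (hP : IsDixmierCone P) {a : A} (ha : 0 ≤ a) :
    a ∈ hP.toIdeal ↔ a ∈ P := by
  rw [mem_toIdeal]
  refine ⟨fun h => ?_, fun h => Submodule.subset_span h⟩
  obtain ⟨b, hb, hab⟩ := hP.exists_add_star_le h
  exact hP.mem_of_add_star_le hb ha hab

theorem isDixmier_toIdeal (hP : IsDixmierCone P) : hP.toIdeal.IsDixmier where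
  positivelySpanned := by
    have h : {a : A | a ∈ hP.toIdeal ∧ 0 ≤ a} = P := by
      ext a
      exact ⟨fun h => (hP.mem_toIdeal_iff_of_nonneg h.2).1 h.1, fun h =>
        ⟨(hP.mem_toIdeal_iff_of_nonneg (hP.nonneg a h)).2 h, hP.nonneg a h⟩⟩
    rw [h]
    ext x
    exact hP.mem_toIdeal
  hereditary a x hx ha hax := by
    have hx0 := ha.trans hax
    rw [hP.mem_toIdeal_iff_of_nonneg ha]
    rw [hP.mem_toIdeal_iff_of_nonneg hx0] at hx
    exact hP.hereditary a x hx ha hax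
  stronglyInvariant x := by
    rw [hP.mem_toIdeal_iff_of_nonneg (star_mul_self_nonneg x),
      hP.mem_toIdeal_iff_of_nonneg (mul_star_self_nonneg x)]
    refine ⟨hP.mul_star_self_mem x, fun h => ?_⟩
    have := hP.mul_star_self_mem (star x)
    rw [star_star] at this
    exact this h

/-- The square root of a Dixmier cone: the positive elements whose square lies in `P`. -/
theorem sqrt (hP : IsDixmierCone P) : IsDixmierCone {a : A | 0 ≤ a ∧ a * a ∈ P} where
  nonneg a ha := ha.1
  zero_mem := ⟨le_rfl, by simpa using hP.zero_mem⟩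
  add_mem a ha b hb := by
    refine ⟨add_nonneg ha.1 hb.1, ?_⟩
    have key : ∀ c : A, 0 ≤ c → c * c ∈ P → c ∈ hP.sqSubmodule := fun c hc h => by
      rwa [mem_sqSubmodule, hc.isSelfAdjoint.star_eq]
    have h := hP.sqSubmodule.add_mem (key a ha.1 ha.2) (key b hb.1 hb.2)
    rwa [mem_sqSubmodule, (add_nonneg ha.1 hb.1).isSelfAdjoint.star_eq] at h
  hereditary a b hb ha hab := by
    refine ⟨ha, ?_⟩
    have hca : CFC.sqrt a * a * CFC.sqrt a = a * a :=
      sqrt_mul_mul_sqrt ha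
    have hcb : CFC.sqrt b * b * CFC.sqrt b = b * b :=
      sqrt_mul_mul_sqrt hb.1
    -- `a * a ≤ y * star y` and `star y * y ≤ b * b` for `y = CFC.sqrt a * CFC.sqrt b`
    have h1 : star (CFC.sqrt a * CFC.sqrt b) * (CFC.sqrt a * CFC.sqrt b) ∈ P := by
      refine hP.hereditary _ _ hb.2 (star_mul_self_nonneg _) ?_
      rw [star_mul, star_sqrt, star_sqrt, mul_assoc, ← mul_assoc (CFC.sqrt a),
        CFC.sqrt_mul_sqrt_self a, ← mul_assoc, ← hcb]
      exact conjugate_le_conjugate_of_nonneg hab (CFC.sqrt_nonneg b)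
    have h2 := hP.mul_star_self_mem _ h1
    rw [star_mul, star_sqrt, star_sqrt, mul_assoc, ← mul_assoc (CFC.sqrt b),
      CFC.sqrt_mul_sqrt_self b hb.1, ← mul_assoc] at h2
    refine hP.hereditary _ _ h2 ?_ ?_
    · have := star_mul_self_nonneg a
      rwa [ha.isSelfAdjoint.star_eq] at this
    · rw [← hca]
      exact conjugate_le_conjugate_of_nonneg hab (CFC.sqrt_nonneg a)
  mul_star_self_mem x hx := by
    refine ⟨mul_star_self_nonneg x, ?_⟩
    set k := x * star x with hk
    have hk0 : 0 ≤ k := mul_star_self_nonneg x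
    -- `y = CFC.sqrt k * x` satisfies `star y * y = (star x * x) ^ 2` and `y * star y = k ^ 2`.
    have h1 : star (CFC.sqrt k * x) * (CFC.sqrt k * x) ∈ P := by
      have : star (CFC.sqrt k * x) * (CFC.sqrt k * x) = star x * x * (star x * x) := by
        rw [star_mul, star_sqrt, mul_assoc, ← mul_assoc (CFC.sqrt k), CFC.sqrt_mul_sqrt_self k, hk]
        simp only [mul_assoc]
      rw [this]
      exact hx.2
    have h2 := hP.mul_star_self_mem _ h1
    have h3 : CFC.sqrt k * x * star (CFC.sqrt k * x) = k * k := by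
      rw [star_mul, star_sqrt, mul_assoc, ← mul_assoc x, ← hk, ← mul_assoc,
        sqrt_mul_mul_sqrt hk0]
    rwa [h3] at h2

theorem mul_mem_toIdeal_of_mem_toIdeal_sqrt (hP : IsDixmierCone P) {x y : A}
    (hx : x ∈ hP.sqrt.toIdeal) (hy : y ∈ hP.sqrt.toIdeal) : x * y ∈ hP.toIdeal := by
  have key : Submodule.span ℂ {a : A | 0 ≤ a ∧ a * a ∈ P} ≤ hP.sqSubmodule := by
    refine Submodule.span_le.2 fun a ha => ?_
    rw [SetLike.mem_coe, mem_sqSubmodule, ha.1.isSelfAdjoint.star_eq]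
    exact ha.2
  rw [mem_toIdeal] at hx hy ⊢
  exact hP.mul_mem_span (key hx) (key hy)

end IsDixmierCone

end DixmierCone

end CStarAlgebra

/-! ### Dixmier ideals squeezing an arbitrary ideal -/

namespace TwoSidedIdeal

section Squeeze

variable {A : Type*} [NonUnitalCStarAlgebra A] [PartialOrder A] [StarOrderedRing A]

open CStarAlgebra

/-- The positive elements having some power of exponent strictly below `t` in `I`. The strict
bound on the exponent absorbs the losses in the stability properties of membership of powers. -/
def powCone (I : TwoSidedIdeal A) (t : ℝ≥0) : Set A :=
  {a | 0 ≤ a ∧ ∃ p : ℝ≥0, 0 < p ∧ p < t ∧ a ^ p ∈ I}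

theorem isDixmierCone_powCone (I : TwoSidedIdeal A) {t : ℝ≥0} (ht : 0 < t) (ht1 : t ≤ 1) :
    IsDixmierCone (I.powCone t) where
  nonneg a ha := ha.1
  zero_mem := ⟨le_rfl, t / 2, by positivity, half_lt_self ht, by simp [I.zero_mem]⟩
  add_mem := by
    rintro a ⟨ha, p, hp, hpt, hap⟩ b ⟨hb, q, hq, hqt, hbq⟩
    obtain ⟨r, hr, hrt⟩ := exists_between (max_lt hpt hqt)
    have hm : 0 < max p q := lt_max_of_lt_left hp
    exact ⟨add_nonneg ha hb, r, hm.trans hr, hrt, add_nnrpow_mem ha hb hm hr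
      (hrt.le.trans ht1) (nnrpow_mem_of_le hp (le_max_left _ _) hap)
      (nnrpow_mem_of_le hq (le_max_right _ _) hbq)⟩
  hereditary := by
    rintro a b ⟨_, p, hp, hpt, hbp⟩ ha hab
    obtain ⟨r, hr, hrt⟩ := exists_between hpt
    exact ⟨ha, r, hp.trans hr, hrt, nnrpow_mem_of_le_of_nnrpow_mem hab hp hr (hrt.le.trans ht1) hbp⟩
  mul_star_self_mem := by
    rintro x ⟨_, p, hp, hpt, hxp⟩
    obtain ⟨r, hr, hrt⟩ := exists_between hpt
    exact ⟨mul_star_self_nonneg x, r, hp.trans hr, hrt, mul_star_self_nnrpow_mem hp hr hxp⟩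

/-- A Dixmier ideal contained in `I`, spanned by the positive elements having a power of exponent
below `1` in `I`. -/
def dixmierInner (I : TwoSidedIdeal A) : TwoSidedIdeal A :=
  (I.isDixmierCone_powCone one_pos le_rfl).toIdeal

/-- A Dixmier ideal containing `I`, spanned by the positive elements whose square has a power of
exponent below `1` in `I`. -/
def dixmierOuter (I : TwoSidedIdeal A) : TwoSidedIdeal A :=
  (I.isDixmierCone_powCone one_pos le_rfl).sqrt.toIdeal

theorem isDixmier_dixmierInner (I : TwoSidedIdeal A) : I.dixmierInner.IsDixmier :=
  IsDixmierCone.isDixmier_toIdeal _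

theorem isDixmier_dixmierOuter (I : TwoSidedIdeal A) : I.dixmierOuter.IsDixmier :=
  IsDixmierCone.isDixmier_toIdeal _

theorem dixmierInner_le (I : TwoSidedIdeal A) : I.dixmierInner ≤ I := by
  intro x hx
  rw [dixmierInner, IsDixmierCone.mem_toIdeal] at hx
  induction hx using Submodule.closure_induction with
  | zero => exact I.zero_mem
  | add x y _ _ hx hy => exact I.add_mem hx hy
  | smul_mem c a ha =>
    obtain ⟨ha, p, hp, hp1, hap⟩ := ha
    have h : c • a = a ^ p * (c • a ^ (1 - p)) := by
      rw [mul_smul_comm, ← CFC.nnrpow_add hp (tsub_pos_of_lt hp1), add_tsub_cancel_of_le hp1.le,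
        CFC.nnrpow_one a]
    rw [h]
    exact I.mul_mem_right _ _ hap

theorem le_dixmierOuter (I : TwoSidedIdeal A) : I ≤ I.dixmierOuter := by
  intro x hx
  set h := star x * x with hh
  have h0 : 0 ≤ h := star_mul_self_nonneg x
  -- For `p = 3 / 8`, `star u * x = h ^ (1 - p) = h ^ (5 / 8)` lies in `I`, and `5 / 8 < 1`.
  obtain ⟨u, hu, hu'⟩ := exists_eq_mul_nnrpow (x := x) (b := h) le_rfl (p := 3 / 8) (by norm_num)
    (by rw [← NNReal.coe_lt_coe]; push_cast; norm_num)
  have hexp : (1 - 2 * (3 / 8) : ℝ≥0) = 1 / 4 := by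
    rw [tsub_eq_iff_eq_add_of_le (by rw [← NNReal.coe_le_coe]; push_cast; norm_num)]
    ext; push_cast; norm_num
  replace hu' : star u * u = h ^ (1 / 4 : ℝ≥0) := by rw [hu' rfl, hexp]
  have hadd : ∀ p q r : ℝ≥0, 0 < p → 0 < q → p + q = r → h ^ p * h ^ q = h ^ r := by
    rintro p q _ hp hq rfl
    exact (CFC.nnrpow_add hp hq).symm
  have hmem : h ^ (5 / 8 : ℝ≥0) ∈ I := by
    have : star u * x = h ^ (5 / 8 : ℝ≥0) := by
      rw [hu, ← mul_assoc, hu']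
      exact hadd _ _ _ (by norm_num) (by norm_num) (by ext; push_cast; norm_num)
    rw [← this]
    exact I.mul_mem_left _ _ hx
  have hcone : h ∈ I.powCone 1 :=
    ⟨h0, 5 / 8, by norm_num, by rw [← NNReal.coe_lt_coe]; push_cast; norm_num, hmem⟩
  set hP := I.isDixmierCone_powCone one_pos le_rfl
  have hhalf : h ^ (1 / 2 : ℝ≥0) ∈ {a : A | 0 ≤ a ∧ a * a ∈ I.powCone 1} := by
    refine ⟨CFC.nnrpow_nonneg, ?_⟩
    rw [hadd _ _ 1 (by norm_num) (by norm_num) (by ext; push_cast; norm_num), CFC.nnrpow_one h]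
    exact hcone
  -- Both factors `y` of this splitting satisfy `star y * y = h ^ (1 / 2)`.
  have hx' : x = (u * h ^ (1 / 8 : ℝ≥0)) * h ^ (1 / 4 : ℝ≥0) := by
    rw [mul_assoc, hadd _ _ (3 / 8) (by norm_num) (by norm_num) (by ext; push_cast; norm_num)]
    exact hu
  rw [dixmierOuter, IsDixmierCone.mem_toIdeal, hx']
  refine hP.sqrt.mul_mem_span ?_ ?_
  · rw [IsDixmierCone.mem_sqSubmodule, star_mul, star_nnrpow, mul_assoc, ← mul_assoc (star u),
      hu', hadd _ _ (3 / 8) (by norm_num) (by norm_num) (by ext; push_cast; norm_num),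
      hadd _ _ (1 / 2) (by norm_num) (by norm_num) (by ext; push_cast; norm_num)]
    exact hhalf
  · rw [IsDixmierCone.mem_sqSubmodule, star_nnrpow,
      hadd _ _ (1 / 2) (by norm_num) (by norm_num) (by ext; push_cast; norm_num)]
    exact hhalf

end Squeeze

end TwoSidedIdeal

/-! ### Powers of ideals in rings -/

namespace TwoSidedIdeal

section Powers

variable {R : Type*} [NonUnitalRing R] {I J : TwoSidedIdeal R}

theorem IsProductOf.mem_idealPow {n : ℕ} {p : R} (h : IsProductOf I n p) : p ∈ I.idealPow n :=
  TwoSidedIdeal.mem_idealPow.2 (AddSubgroup.subset_closure h)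

theorem idealPow_le_iff {n : ℕ} : I.idealPow n ≤ J ↔ ∀ p, IsProductOf I n p → p ∈ J := by
  refine ⟨fun h p hp => h hp.mem_idealPow, fun h x hx => ?_⟩
  rw [mem_idealPow] at hx
  induction hx using AddSubgroup.closure_induction with
  | mem p hp => exact h p hp
  | zero => exact J.zero_mem
  | add x y _ _ hx hy => exact J.add_mem hx hy
  | neg x _ hx => exact J.neg_mem hx

theorem isProductOf_one_iff {p : R} : IsProductOf I 1 p ↔ p ∈ I := by
  refine ⟨fun h => ?_, .single⟩
  cases h with
  | single h => exact h
  | mul hp _ => nomatch hp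

theorem isProductOf_two_iff {p : R} : IsProductOf I 2 p ↔ ∃ y ∈ I, ∃ z ∈ I, p = y * z := by
  refine ⟨fun h => ?_, fun ⟨y, hy, z, hz, h⟩ => h ▸ .mul (.single hy) hz⟩
  cases h with
  | mul hp hx => exact ⟨_, isProductOf_one_iff.1 hp, _, hx, rfl⟩

theorem idealPow_one : I.idealPow 1 = I :=
  le_antisymm (idealPow_le_iff.2 fun _ => isProductOf_one_iff.1)
    fun _ hx => (IsProductOf.single hx).mem_idealPow

theorem idealPow_two_le_iff : I.idealPow 2 ≤ J ↔ ∀ y ∈ I, ∀ z ∈ I, y * z ∈ J := by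
  rw [idealPow_le_iff]
  exact ⟨fun h y hy z hz => h _ (.mul (.single hy) hz), fun h p hp => by
    obtain ⟨y, hy, z, hz, rfl⟩ := isProductOf_two_iff.1 hp
    exact h y hy z hz⟩

theorem idealPow_two_le : I.idealPow 2 ≤ I :=
  idealPow_two_le_iff.2 fun _ _ _ hz => I.mul_mem_left _ _ hz

theorem idealPow_two_mono (h : I ≤ J) : I.idealPow 2 ≤ J.idealPow 2 :=
  idealPow_two_le_iff.2 fun _ hy _ hz => (IsProductOf.mul (.single (h hy)) (h hz)).mem_idealPow

theorem IsProductOf.mem {n : ℕ} {p : R} (h : IsProductOf I n p) : p ∈ I := by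
  cases h with
  | single h => exact h
  | mul _ h => exact I.mul_mem_left _ _ h

theorem IsProductOf.exists_mul {m k : ℕ} (hm : 1 ≤ m) (hk : 1 ≤ k) {p : R}
    (h : IsProductOf I (m + k) p) : ∃ q r, IsProductOf I m q ∧ IsProductOf I k r ∧ p = q * r := by
  induction k, hk using Nat.le_induction generalizing p with
  | base =>
    cases h with
    | single _ => omega
    | mul hp hx => exact ⟨_, _, hp, .single hx, rfl⟩
  | succ k hk ih =>
    generalize hN : m + (k + 1) = N at h
    cases h with
    | single _ => omega
    | @mul n _ _ hp hx =>
      obtain rfl : n = m + k := by omega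
      obtain ⟨q, r, hq, hr, rfl⟩ := ih hp
      exact ⟨q, _, hq, .mul hr hx, mul_assoc _ _ _⟩

theorem idealPow_add_le {m k : ℕ} (hm : 1 ≤ m) : I.idealPow (m + k) ≤ I.idealPow m := by
  rcases k.eq_zero_or_pos with rfl | hk
  · exact le_rfl
  · refine idealPow_le_iff.2 fun p hp => ?_
    obtain ⟨q, r, hq, -, rfl⟩ := hp.exists_mul hm hk
    exact (I.idealPow m).mul_mem_right _ _ hq.mem_idealPow

theorem idealPow_add_self_le {m : ℕ} (hm : 1 ≤ m) :
    I.idealPow (m + m) ≤ (I.idealPow m).idealPow 2 := by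
  refine idealPow_le_iff.2 fun p hp => ?_
  obtain ⟨q, r, hq, hr, rfl⟩ := hp.exists_mul hm hm
  exact (isProductOf_two_iff.2 ⟨q, hq.mem_idealPow, r, hr.mem_idealPow, rfl⟩).mem_idealPow

theorem idealPow_succ_le_of_le {m n : ℕ} (hm : 1 ≤ m) (h : I.idealPow m ≤ I.idealPow n) :
    I.idealPow (m + 1) ≤ I.idealPow (n + 1) := by
  refine idealPow_le_iff.2 fun p hp => ?_
  obtain ⟨q, r, hq, hr, rfl⟩ := hp.exists_mul hm le_rfl
  have hq' := mem_idealPow.1 (h hq.mem_idealPow)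
  replace hr := isProductOf_one_iff.1 hr
  clear hp hq
  induction hq' using AddSubgroup.closure_induction with
  | mem q hq => exact (hq.mul hr).mem_idealPow
  | zero => rw [zero_mul]; exact TwoSidedIdeal.zero_mem _
  | add x y _ _ hx hy => rw [add_mul]; exact TwoSidedIdeal.add_mem _ hx hy
  | neg x _ hx => rw [neg_mul]; exact TwoSidedIdeal.neg_mem _ hx

/-- Once the descending chain of powers repeats, the repeating power is idempotent. -/
theorem idealPow_idealPow_two_eq_of_le {m d : ℕ} (hm : 1 ≤ m) (hd : 1 ≤ d)
    (h : I.idealPow m ≤ I.idealPow (m + d)) : (I.idealPow m).idealPow 2 = I.idealPow m := by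
  have hstep : ∀ j, I.idealPow (m + j) ≤ I.idealPow (m + j + d) := by
    intro j
    induction j with
    | zero => exact h
    | succ j ih =>
      have := idealPow_succ_le_of_le (by omega) ih
      rwa [show m + j + d + 1 = m + (j + 1) + d by ring] at this
  have hiter : ∀ j, I.idealPow m ≤ I.idealPow (m + j * d) := by
    intro j
    induction j with
    | zero => simp
    | succ j ih =>
      refine ih.trans ((hstep _).trans_eq ?_)
      congr 1; ring
  refine le_antisymm idealPow_two_le (((hiter m).trans ?_).trans (idealPow_add_self_le hm))
  have hmd : m + m * d = (m + m) + m * (d - 1) := by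
    obtain ⟨e, rfl⟩ := Nat.exists_eq_add_of_le hd
    simp; ring
  rw [hmd]
  exact idealPow_add_le (by omega)

theorem Factors.idealPow_two_eq (h : I.Factors) : I.idealPow 2 = I :=
  le_antisymm idealPow_two_le fun x hx => (isProductOf_two_iff.2 (h x hx)).mem_idealPow

end Powers

/-! ### Weak factorization, Dixmier interior and Dixmier closure -/

section WeakFactorization

variable {A : Type*} [NonUnitalCStarAlgebra A] {I : TwoSidedIdeal A}

theorem Factors.factorsWeakly (h : I.Factors) : I.FactorsWeakly := by
  refine Set.Subset.antisymm (fun x hx => Submodule.subset_span (h x hx)) fun x hx => ?_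
  induction hx using Submodule.closure_induction with
  | zero => exact I.zero_mem
  | add x y _ _ hx hy => exact I.add_mem hx hy
  | smul_mem c p hp =>
    obtain ⟨y, -, z, hz, rfl⟩ := hp
    rw [← smul_mul_assoc]
    exact I.mul_mem_left _ _ hz

theorem FactorsWeakly.idealPow_two_eq (h : I.FactorsWeakly) : I.idealPow 2 = I := by
  -- An ideal need not be a subspace; here it is one because it equals a linear span.
  have hsmul : ∀ (c : ℂ), ∀ y ∈ I, c • y ∈ I := by
    intro c y hy
    have hy' : y ∈ (I : Set A) := hy
    rw [h] at hy'
    have : c • y ∈ (I : Set A) := by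
      rw [h]
      exact Submodule.smul_mem _ c hy'
    exact this
  refine le_antisymm idealPow_two_le fun x hx => ?_
  have hx' : x ∈ (I : Set A) := hx
  rw [h] at hx'
  clear hx
  induction hx' using Submodule.closure_induction with
  | zero => exact TwoSidedIdeal.zero_mem _
  | add x y _ _ hx hy => exact TwoSidedIdeal.add_mem _ hx hy
  | smul_mem c p hp =>
    obtain ⟨y, hy, z, hz, rfl⟩ := hp
    rw [← smul_mul_assoc]
    exact (isProductOf_two_iff.2 ⟨_, hsmul c y hy, z, hz, rfl⟩).mem_idealPow

end WeakFactorization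

section Envelopes

variable {A : Type*} [NonUnitalCStarAlgebra A] [PartialOrder A] {I : TwoSidedIdeal A}

theorem dixmierInterior_le (I : TwoSidedIdeal A) : I.dixmierInterior ≤ I :=
  sSup_le fun _ hJ => hJ.2

theorem le_dixmierClosure (I : TwoSidedIdeal A) : I ≤ I.dixmierClosure :=
  le_sInf fun _ hJ => hJ.2

theorem IsDixmier.dixmierInterior_eq (h : I.IsDixmier) : I.dixmierInterior = I :=
  le_antisymm I.dixmierInterior_le (le_sSup ⟨h, le_rfl⟩)

theorem IsDixmier.dixmierClosure_eq (h : I.IsDixmier) : I.dixmierClosure = I :=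
  le_antisymm (sInf_le ⟨h, le_rfl⟩) I.le_dixmierClosure

end Envelopes

/-! ### Equivalent forms of semiprimeness -/

section CStar

variable {A : Type*} [NonUnitalCStarAlgebra A] [PartialOrder A] [StarOrderedRing A]
  {I J : TwoSidedIdeal A}

open CStarAlgebra

theorem dixmierOuter_idealPow_two_le (I : TwoSidedIdeal A) :
    I.dixmierOuter.idealPow 2 ≤ I.dixmierInner :=
  idealPow_two_le_iff.2 fun _ hy _ hz =>
    IsDixmierCone.mul_mem_toIdeal_of_mem_toIdeal_sqrt _ hy hz

theorem IsSemiprimeIdeal.eq_dixmierOuter (h : I.IsSemiprimeIdeal) : I.dixmierOuter = I :=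
  le_antisymm (h _ ((dixmierOuter_idealPow_two_le I).trans I.dixmierInner_le)) I.le_dixmierOuter

/-- A semiprime ideal `I` equals its outer Dixmier ideal, and the square root of the cone of the
latter spans an ideal whose square is contained in `I`, hence which is itself contained in `I`. -/
theorem IsSemiprimeIdeal.closedUnderSqrt (h : I.IsSemiprimeIdeal) : I.ClosedUnderSqrt := by
  intro a ha ha0
  set hP := (I.isDixmierCone_powCone one_pos le_rfl).sqrt
  have hle : hP.toIdeal ≤ I := h.eq_dixmierOuter.le
  have hsq : hP.sqrt.toIdeal ≤ I := by
    refine h _ (idealPow_two_le_iff.2 fun y hy z hz => hle ?_)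
    exact hP.mul_mem_toIdeal_of_mem_toIdeal_sqrt hy hz
  have haP : a ∈ hP.toIdeal := I.le_dixmierOuter ha
  rw [hP.mem_toIdeal_iff_of_nonneg ha0] at haP
  refine hsq ((hP.sqrt.mem_toIdeal_iff_of_nonneg (CFC.sqrt_nonneg a)).2
    ⟨CFC.sqrt_nonneg a, ?_⟩)
  rwa [CFC.sqrt_mul_sqrt_self a]

/-- An idempotent ideal `I` equals its inner Dixmier ideal, so `star z * z` lies in
`I.powCone (1 / 2)` for all `z ∈ I`. By polarization every positive element of `I = I ^ 2` lies
in that cone. -/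
theorem closedUnderSqrt_of_idealPow_two_eq (h : I.idealPow 2 = I) : I.ClosedUnderSqrt := by
  have hinner : I ≤ I.dixmierInner := by
    conv_lhs => rw [← h]
    exact (idealPow_two_mono I.le_dixmierOuter).trans I.dixmierOuter_idealPow_two_le
  have hP := I.isDixmierCone_powCone (t := 1 / 2) (by norm_num)
    (by rw [← NNReal.coe_le_coe]; push_cast; norm_num)
  have hsub : ∀ z ∈ I, z ∈ hP.sqSubmodule := by
    intro z hz
    have hz' := hinner hz
    rw [dixmierInner, IsDixmierCone.mem_toIdeal] at hz'
    refine Submodule.span_le.2 (fun a ha => ?_) hz'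
    obtain ⟨ha0, p, hp, hp1, hap⟩ := ha
    rw [SetLike.mem_coe, IsDixmierCone.mem_sqSubmodule, ha0.isSelfAdjoint.star_eq]
    refine ⟨by simpa [ha0.isSelfAdjoint.star_eq] using star_mul_self_nonneg a, p / 2,
      by positivity, by gcongr, ?_⟩
    rwa [← CFC.nnrpow_two a, CFC.nnrpow_nnrpow, mul_div_cancel₀ _ two_ne_zero]
  intro a ha ha0
  have hspan : a ∈ hP.toIdeal := by
    refine idealPow_two_le_iff.2 (fun y hy z hz => ?_) (h.ge ha)
    exact hP.mem_toIdeal.2 (hP.mul_mem_span (hsub y hy) (hsub z hz))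
  obtain ⟨-, p, hp, hp1, hap⟩ := (hP.mem_toIdeal_iff_of_nonneg ha0).1 hspan
  rw [CFC.sqrt_eq_nnrpow]
  exact nnrpow_mem_of_le hp hp1.le hap

theorem ClosedUnderRoots.closedUnderSqrt (h : I.ClosedUnderRoots) : I.ClosedUnderSqrt := by
  intro a ha ha0
  rw [CFC.sqrt_eq_nnrpow]
  simpa using h a ha ha0 2 one_le_two

theorem ClosedUnderSqrt.closedUnderRoots (h : I.ClosedUnderSqrt) : I.ClosedUnderRoots := by
  have hpow : ∀ a ∈ I, 0 ≤ a → ∀ k : ℕ, a ^ (((2 ^ k : ℕ) : ℝ≥0)⁻¹) ∈ I := by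
    intro a ha ha0 k
    induction k with
    | zero => simpa [CFC.nnrpow_one a] using ha
    | succ k ih =>
      have h1 := h _ ih CFC.nnrpow_nonneg
      rw [CFC.sqrt_nnrpow] at h1
      convert h1 using 2
      rw [pow_succ]; push_cast; field_simp
  intro a ha ha0 n hn
  refine nnrpow_mem_of_le (by positivity) ?_ (hpow a ha ha0 n)
  gcongr
  exact n.lt_two_pow_self.le

theorem mem_of_nnrpow_quarter_mem {x : A} (h : (star x * x) ^ (((4 : ℕ) : ℝ≥0)⁻¹) ∈ I) :
    x ∈ I := by
  obtain ⟨u, hu, -⟩ := exists_eq_mul_nnrpow (x := x) le_rfl (p := ((4 : ℕ) : ℝ≥0)⁻¹)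
    (by norm_num) (by rw [← NNReal.coe_lt_coe]; push_cast; norm_num)
  rw [hu]
  exact I.mul_mem_left _ _ h

theorem isProductOf_nnrpow {a : A} (ha : a ∈ I) (ha0 : 0 ≤ a) {n : ℕ} (hn : 1 ≤ n) :
    IsProductOf I n (a ^ (n : ℝ≥0)) := by
  induction n, hn using Nat.le_induction with
  | base => simpa [CFC.nnrpow_one a] using IsProductOf.single ha
  | succ n hn ih =>
    rw [Nat.cast_succ, CFC.nnrpow_add (by positivity) one_pos, CFC.nnrpow_one a]
    exact ih.mul ha

/-- If `x ∈ J`, then `(star x * x) ^ n` lies in `J ^ n`; taking roots, `I` contains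
`(star x * x) ^ (1 / 4)`, of which `x` is a multiple. -/
theorem ClosedUnderRoots.le_of_idealPow_le (h : I.ClosedUnderRoots) {n : ℕ} (hn : 1 ≤ n)
    (hJ : J.idealPow n ≤ I) : J ≤ I := by
  intro x hx
  have h0 := star_mul_self_nonneg x
  have h1 := hJ (isProductOf_nnrpow (J.mul_mem_left (star x) x hx) h0 hn).mem_idealPow
  have h2 := h _ h1 CFC.nnrpow_nonneg (n * 4) (by omega)
  rw [CFC.nnrpow_nnrpow] at h2
  refine mem_of_nnrpow_quarter_mem ?_
  convert h2 using 2
  have : (n : ℝ≥0) ≠ 0 := by positivity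
  push_cast; field_simp

theorem ClosedUnderRoots.isSemiprimeIdeal (h : I.ClosedUnderRoots) : I.IsSemiprimeIdeal :=
  fun _ => h.le_of_idealPow_le one_le_two

theorem ClosedUnderRoots.factors (h : I.ClosedUnderRoots) : I.Factors := by
  intro x hx
  obtain ⟨u, hu, -⟩ := exists_eq_mul_nnrpow (x := x) le_rfl (p := ((4 : ℕ) : ℝ≥0)⁻¹)
    (by norm_num) (by rw [← NNReal.coe_lt_coe]; push_cast; norm_num)
  -- `x = u * h ^ (1 / 4) = (u * h ^ (1 / 8)) * h ^ (1 / 8)` with `h = star x * x`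
  have hmem := h _ (I.mul_mem_left (star x) x hx) (star_mul_self_nonneg x) 8 (by norm_num)
  refine ⟨u * _, I.mul_mem_left _ _ hmem, _, hmem, ?_⟩
  rw [mul_assoc, ← CFC.nnrpow_add (by norm_num) (by norm_num)]
  nth_rewrite 1 [hu]
  congr 2
  ext; push_cast; norm_num

theorem dixmierInner_le_dixmierInterior (I : TwoSidedIdeal A) :
    I.dixmierInner ≤ I.dixmierInterior :=
  le_sSup ⟨I.isDixmier_dixmierInner, I.dixmierInner_le⟩

theorem dixmierClosure_le_dixmierOuter (I : TwoSidedIdeal A) :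
    I.dixmierClosure ≤ I.dixmierOuter :=
  sInf_le ⟨I.isDixmier_dixmierOuter, I.le_dixmierOuter⟩

theorem dixmierClosure_idealPow_two_le (I : TwoSidedIdeal A) :
    I.dixmierClosure.idealPow 2 ≤ I.dixmierInterior :=
  (idealPow_two_mono I.dixmierClosure_le_dixmierOuter).trans
    (I.dixmierOuter_idealPow_two_le.trans I.dixmierInner_le_dixmierInterior)

theorem IsSemiprimeIdeal.isDixmier (h : I.IsSemiprimeIdeal) : I.IsDixmier :=
  h.eq_dixmierOuter ▸ I.isDixmier_dixmierOuter

theorem IsSemiprimeIdeal.idealPow_two_eq (h : I.IsSemiprimeIdeal) : I.idealPow 2 = I :=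
  h.closedUnderSqrt.closedUnderRoots.factors.idealPow_two_eq

theorem isSemiprimeIdeal_of_dixmierInterior (h : I.dixmierInterior.IsSemiprimeIdeal) :
    I.IsSemiprimeIdeal := by
  have hle : I ≤ I.dixmierInterior :=
    I.le_dixmierClosure.trans (h _ I.dixmierClosure_idealPow_two_le)
  rwa [le_antisymm I.dixmierInterior_le hle] at h

theorem isSemiprimeIdeal_of_dixmierClosure (h : I.dixmierClosure.IsSemiprimeIdeal) :
    I.IsSemiprimeIdeal := by
  have hle : I.dixmierClosure ≤ I :=
    h.idealPow_two_eq.ge.trans (I.dixmierClosure_idealPow_two_le.trans I.dixmierInterior_le)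
  rwa [le_antisymm hle I.le_dixmierClosure] at h

theorem isSemiprimeIdeal_of_idealPow_eq {m n : ℕ} (hm : 1 ≤ m) (hmn : m < n)
    (h : I.idealPow m = I.idealPow n) : I.IsSemiprimeIdeal := by
  obtain ⟨d, rfl⟩ := Nat.exists_eq_add_of_lt hmn
  have hidem := idealPow_idealPow_two_eq_of_le (d := d + 1) hm (by omega) h.le
  have hroots := (closedUnderSqrt_of_idealPow_two_eq hidem).closedUnderRoots
  have hle : I ≤ I.idealPow m := hroots.le_of_idealPow_le hm le_rfl
  have hge : I.idealPow m ≤ I := idealPow_le_iff.2 fun _ hp => hp.mem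
  rw [← le_antisymm hge hle]
  exact hroots.isSemiprimeIdeal

end CStar

end TwoSidedIdeal

theorem theorem4p3 {A : Type*} [NonUnitalCStarAlgebra A] [PartialOrder A] [StarOrderedRing A]
    (I : TwoSidedIdeal A) :
    List.TFAE
      [ I.IsSemiprimeIdeal,
        I.idealPow 2 = I,
        I.FactorsWeakly,
        ∃ m n : ℕ, 1 ≤ m ∧ 1 ≤ n ∧ m ≠ n ∧ I.idealPow m = I.idealPow n,
        I.Factors,
        I.ClosedUnderRoots,
        I.ClosedUnderSqrt,
        I.dixmierInterior.IsSemiprimeIdeal,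
        I.dixmierClosure.IsSemiprimeIdeal ] ∧
    (I.IsSemiprimeIdeal →
      I.IsDixmier ∧ I.dixmierInterior = I ∧ I.dixmierClosure = I) := by
  constructor
  · tfae_have 1 → 7 := fun h => h.closedUnderSqrt
    tfae_have 7 → 6 := fun h => h.closedUnderRoots
    tfae_have 6 → 5 := fun h => h.factors
    tfae_have 5 → 3 := fun h => h.factorsWeakly
    tfae_have 3 → 2 := fun h => h.idealPow_two_eq
    tfae_have 2 → 4 := fun h => ⟨2, 1, one_le_two, le_rfl, by decide, by
      rw [h, TwoSidedIdeal.idealPow_one]⟩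
    tfae_have 4 → 1 := by
      rintro ⟨m, n, hm, hn, hmn, h⟩
      rcases hmn.lt_or_gt with hlt | hlt
      · exact TwoSidedIdeal.isSemiprimeIdeal_of_idealPow_eq hm hlt h
      · exact TwoSidedIdeal.isSemiprimeIdeal_of_idealPow_eq hn hlt h.symm
    tfae_have 1 → 8 := fun h => by rwa [h.isDixmier.dixmierInterior_eq]
    tfae_have 8 → 1 := TwoSidedIdeal.isSemiprimeIdeal_of_dixmierInterior
    tfae_have 1 → 9 := fun h => by rwa [h.isDixmier.dixmierClosure_eq]
    tfae_have 9 → 1 := TwoSidedIdeal.isSemiprimeIdeal_of_dixmierClosure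
    tfae_finish
  · exact fun h => ⟨h.isDixmier, h.isDixmier.dixmierInterior_eq, h.isDixmier.dixmierClosure_eq⟩
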